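/- Let $k$ be a commutative ring, $I$ a free $k$-module of finite rank, and $k[I]=k\oplus I$ with $I^2=0$. Let $h:\mathrm{Spec}\,k[I]\to\mathrm{Spec}\,k$ be the structure map, $i:\mathrm{Spec}\,k\to\mathrm{Spec}\,k[I]$ the closed immersion defined by $I$, and identify $i^*h^*$ with the identity. Let $G$ be an affine $k$-group scheme. Let $T(G,I)=h_*h^*G$ be the group functor on $k$-schemes whose group of $T$-points is the group of $k[I]$-morphisms $h^*T\to h^*G$; restriction along $i$ gives a homomorphism $T(G,I)\to G$ with section $\alpha:G\to T(G,I)$, $g\mapsto h^*g$. Its kernel $\mathrm{Lie}(G,I)$ is commutative and is written additively; for a point $x$ of $\mathrm{Lie}(G,I)$ write $1+x$ for the corresponding point of $T(G,I)$. The group $G$ acts on $\mathrm{Lie}(G,I)$ by the adjoint action $1+\mathrm{Ad}(g)x=\alpha(g)(1+x)\alpha(g)^{-1}$. A $2$-cocycle is a morphism $c:G\times G\to\mathrm{Lie}(G,I)$ such that $c(u,v)+c(uv,w)=\mathrm{Ad}(u)c(v,w)+c(u,vw)$ for all points $u,v,w$ of $G$ with values in any $k$-scheme. The coboundary of a morphism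 $\psi:G\to\mathrm{Lie}(G,I)$ is $(u,v)\mapsto\mathrm{Ad}(u)\psi(v)-\psi(uv)+\psi(u)$, and $\mathrm{H}^2(G,\mathrm{Lie}(G,I))$ is the group of $2$-cocycles modulo coboundaries. A deformation of $G$ over $k[I]$ is a $k[I]$-group scheme $\mathscr{G}$ (flat over $k[I]$ if $G$ is flat over $k$) together with an isomorphism of $k$-group schemes $i^*\mathscr{G}\simeq G$; an isomorphism of deformations is an isomorphism of $k[I]$-group schemes compatible with the identifications of the special fibres with $G$. It is rigid if there exists an isomorphism of $k[I]$-schemes $h^*i^*\mathscr{G}\simeq\mathscr{G}$ (not necessarily a group homomorphism) lifting the identity of $i^*\mathscr{G}$. Then: (1) There is a bijection $c\mapsto\mathscr{G}_c$ from the set of $2$-cocycles $c:G\times G\to\mathrm{Lie}(G,I)$ to the set of $k[I]$-group scheme structures on the $k[I]$-scheme $h^*G$ that lift the $k$-group scheme structure of $G$. It is such that the multiplication $\odot$ of $\mathscr{G}_c$ satisfies, for all points $u,v$ of $G$ with values in a $k$-scheme $T$, the identity $\alpha(u)\odot\alpha(v)=(1+c(u,v))\cdot\alpha(uv)$ in $T(G,I)(T)$.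 (2) There is a bijection from $\mathrm{H}^2(G,\mathrm{Lie}(G,I))$ to the set of isomorphism classes of rigid deformations of $G$ over $k[I]$, which sends the class of a $2$-cocycle $c$ to the isomorphism class of $\mathscr{G}_c$. -/

import Mathlib

universe u

open CategoryTheory MonoidalCategory CartesianMonoidalCategory Limits AlgebraicGeometry

open scoped CategoryTheory.MonObj CategoryTheory.Obj

noncomputable section

namespace GroupDeformation

/-- If `h` has a section `i`, pulling `f` back along `h` and then along `i` gives `f` again. -/
def iteratedPullbackIso {X T T' : Scheme.{u}} (f : X ⟶ T) (h : T' ⟶ T) (i : T ⟶ T')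
    (hi : i ≫ h = 𝟙 T) : pullback (pullback.snd f h) i ≅ X where
  hom := pullback.fst _ _ ≫ pullback.fst _ _
  inv := pullback.lift (pullback.lift (𝟙 _) (f ≫ i) (by simp [hi])) f
    (by rw [pullback.lift_snd])
  hom_inv_id := by
    have key : (pullback.fst (pullback.snd f h) i ≫ pullback.fst f h) ≫ f = pullback.snd _ _ := by
      rw [Category.assoc, pullback.condition, ← Category.assoc, pullback.condition,
        Category.assoc, hi, Category.comp_id]
    apply pullback.hom_ext
    · apply pullback.hom_ext
      · simp only [Category.assoc, pullback.lift_fst, Category.comp_id, Category.id_comp]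
      · have := pullback.condition (f := pullback.snd f h) (g := i)
        simp only [Category.assoc, pullback.lift_fst_assoc, pullback.lift_snd, Category.id_comp]
        rw [this, ← key]
        simp only [Category.assoc]
    · rw [Category.assoc, pullback.lift_snd, key, Category.id_comp]
  inv_hom_id := by rw [pullback.lift_fst_assoc, pullback.lift_fst]

lemma iteratedPullbackIso_hom_comp {X T T' : Scheme.{u}} (f : X ⟶ T) (h : T' ⟶ T) (i : T ⟶ T')
    (hi : i ≫ h = 𝟙 T) :
    (iteratedPullbackIso f h i hi).hom ≫ f = pullback.snd (pullback.snd f h) i := by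
  simp only [iteratedPullbackIso]
  rw [Category.assoc, pullback.condition, ← Category.assoc, pullback.condition,
    Category.assoc, hi, Category.comp_id]

section Base

variable (k I : Type u) [CommRing k] [AddCommGroup I] [Module k I] [Module kᵐᵒᵖ I]
  [IsCentralScalar k I]

/-- The base scheme `Spec k`. -/
abbrev S : Scheme.{u} := Spec (.of k)

/-- The thickened base `Spec k[I]`, where `k[I] = k ⊕ I` with `I² = 0`. -/
abbrev SI : Scheme.{u} := Spec (.of (TrivSqZeroExt k I))

/-- The structure map `h : Spec k[I] ⟶ Spec k`. -/
def h : SI k I ⟶ S k :=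
  Spec.map (CommRingCat.ofHom (algebraMap k (TrivSqZeroExt k I)))

/-- The closed immersion `i : Spec k ⟶ Spec k[I]` defined by the ideal `I`. -/
def i : S k ⟶ SI k I :=
  Spec.map (CommRingCat.ofHom (TrivSqZeroExt.fstHom k k I).toRingHom)

lemma i_h : i k I ≫ h k I = 𝟙 (S k) := by
  rw [i, h, ← Spec.map_comp, ← CommRingCat.ofHom_comp, ← Spec.map_id]
  congr 1

/-- The base change functor `h^*` from `k`-schemes to `k[I]`-schemes. -/
abbrev hPull : Over (S k) ⥤ Over (SI k I) := Over.pullback (h k I)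

/-- The restriction functor `i^*` from `k[I]`-schemes to `k`-schemes; `i^* X` is the special
fibre of `X`. -/
abbrev iPull : Over (SI k I) ⥤ Over (S k) := Over.pullback (i k I)

/-- The canonical isomorphism `i^* h^* X ≅ X` (on underlying schemes, the projection). -/
def specialFibre (X : Over (S k)) : (iPull k I).obj ((hPull k I).obj X) ≅ X :=
  Over.isoMk (iteratedPullbackIso X.hom (h k I) (i k I) (i_h k I))
    (iteratedPullbackIso_hom_comp X.hom (h k I) (i k I) (i_h k I))

lemma specialFibre_natural {X Y : Over (S k)} (f : X ⟶ Y) :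
    (iPull k I).map ((hPull k I).map f) ≫ (specialFibre k I Y).hom =
      (specialFibre k I X).hom ≫ f := by
  have h1 : ((hPull k I).map f).left ≫ pullback.fst Y.hom (h k I) =
      pullback.fst X.hom (h k I) ≫ f.left := pullback.lift_fst _ _ _
  have h2 : ((iPull k I).map ((hPull k I).map f)).left ≫
      pullback.fst ((hPull k I).obj Y).hom (i k I) =
      pullback.fst ((hPull k I).obj X).hom (i k I) ≫ ((hPull k I).map f).left :=
    pullback.lift_fst _ _ _
  apply Over.OverMorphism.ext
  change ((iPull k I).map ((hPull k I).map f)).left ≫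
    pullback.fst ((hPull k I).obj Y).hom (i k I) ≫ pullback.fst Y.hom (h k I) =
      (pullback.fst ((hPull k I).obj X).hom (i k I) ≫ pullback.fst X.hom (h k I)) ≫ f.left
  rw [reassoc_of% h2, h1, Category.assoc]

end Base
section Comm

variable {R : Type u} [CommRing R] (J : Ideal R)

/-- The fibre product `R ×_{R/J} R ×_{R/J} R`. -/
def tripleRing : Subring (R × R × R) where
  carrier := {f | f.2.1 - f.1 ∈ J ∧ f.2.2 - f.1 ∈ J}
  mul_mem' := by
    rintro ⟨a, b, c⟩ ⟨a', b', c'⟩ ⟨h1, h2⟩ ⟨h3, h4⟩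
    dsimp at *
    constructor
    · have : b * b' - a * a' = b * (b' - a') + a' * (b - a) := by ring
      rw [this]; exact J.add_mem (J.mul_mem_left _ h3) (J.mul_mem_left _ h1)
    · have : c * c' - a * a' = c * (c' - a') + a' * (c - a) := by ring
      rw [this]; exact J.add_mem (J.mul_mem_left _ h4) (J.mul_mem_left _ h2)
  one_mem' := by simp
  add_mem' := by
    rintro ⟨a, b, c⟩ ⟨a', b', c'⟩ ⟨h1, h2⟩ ⟨h3, h4⟩
    dsimp at *
    constructor
    · have : b + b' - (a + a') = (b - a) + (b' - a') := by ring
      rw [this]; exact J.add_mem h1 h3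
    · have : c + c' - (a + a') = (c - a) + (c' - a') := by ring
      rw [this]; exact J.add_mem h2 h4
  zero_mem' := by simp
  neg_mem' := by
    rintro ⟨a, b, c⟩ ⟨h1, h2⟩
    dsimp at *
    constructor
    · have : -b - -a = -(b - a) := by ring
      rw [this]; exact J.neg_mem h1
    · have : -c - -a = -(c - a) := by ring
      rw [this]; exact J.neg_mem h2

def triplePr0 : tripleRing J →+* R := (RingHom.fst R (R × R)).comp (tripleRing J).subtype
def triplePr1 : tripleRing J →+* R :=
  ((RingHom.fst R R).comp (RingHom.snd R (R × R))).comp (tripleRing J).subtype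
def triplePr2 : tripleRing J →+* R :=
  ((RingHom.snd R R).comp (RingHom.snd R (R × R))).comp (tripleRing J).subtype

def tripleDiag : R →+* tripleRing J where
  toFun r := ⟨(r, r, r), by simp [tripleRing]⟩
  map_one' := rfl
  map_mul' _ _ := rfl
  map_zero' := rfl
  map_add' _ _ := rfl

/-- The "sum" `(a, b, c) ↦ b + c - a`, a ring map because `J² = 0`. -/
def tripleSum (hJ : ∀ a ∈ J, ∀ b ∈ J, a * b = 0) : tripleRing J →+* R where
  toFun f := f.1.2.1 + f.1.2.2 - f.1.1
  map_one' := by simp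
  map_zero' := by simp
  map_add' f g := by simp only [Subring.coe_add, Prod.snd_add, Prod.fst_add]; ring
  map_mul' := by
    rintro ⟨⟨a, b, c⟩, h1, h2⟩ ⟨⟨a', b', c'⟩, h3, h4⟩
    dsimp at *
    have e1 := hJ _ h1 _ h4
    have e2 := hJ _ h2 _ h3
    linear_combination (-1 : R) * e1 - e2

lemma triple_ext {Y : Scheme.{u}} [IsAffine Y] {f g : Spec (.of (tripleRing J)) ⟶ Y}
    (h0 : Spec.map (CommRingCat.ofHom (triplePr0 J)) ≫ f =
      Spec.map (CommRingCat.ofHom (triplePr0 J)) ≫ g)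
    (h1 : Spec.map (CommRingCat.ofHom (triplePr1 J)) ≫ f =
      Spec.map (CommRingCat.ofHom (triplePr1 J)) ≫ g)
    (h2 : Spec.map (CommRingCat.ofHom (triplePr2 J)) ≫ f =
      Spec.map (CommRingCat.ofHom (triplePr2 J)) ≫ g) : f = g := by
  rw [← cancel_mono Y.isoSpec.hom]
  obtain ⟨φ, hφ⟩ := Spec.map_surjective (f ≫ Y.isoSpec.hom)
  obtain ⟨ψ, hψ⟩ := Spec.map_surjective (g ≫ Y.isoSpec.hom)
  rw [← hφ, ← hψ]
  congr 1
  have aux : ∀ p : tripleRing J →+* R, Spec.map (CommRingCat.ofHom p) ≫ f =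
      Spec.map (CommRingCat.ofHom p) ≫ g → ∀ b, p (φ.hom b) = p (ψ.hom b) := by
    intro p hp b
    have : Spec.map (CommRingCat.ofHom p) ≫ Spec.map φ =
        Spec.map (CommRingCat.ofHom p) ≫ Spec.map ψ := by
      rw [hφ, hψ, ← Category.assoc, hp, Category.assoc]
    rw [← Spec.map_comp, ← Spec.map_comp] at this
    exact congr($(Spec.map_injective this).hom b)
  refine CommRingCat.hom_ext (RingHom.ext fun b ↦ ?_)
  apply Subtype.ext
  exact Prod.ext (aux _ h0 b) (Prod.ext (aux _ h1 b) (aux _ h2 b))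

lemma triple_exists {Y : Scheme.{u}} [IsAffine Y] (f0 f1 f2 : Spec (.of R) ⟶ Y)
    (h1 : Spec.map (CommRingCat.ofHom (Ideal.Quotient.mk J)) ≫ f1 =
      Spec.map (CommRingCat.ofHom (Ideal.Quotient.mk J)) ≫ f0)
    (h2 : Spec.map (CommRingCat.ofHom (Ideal.Quotient.mk J)) ≫ f2 =
      Spec.map (CommRingCat.ofHom (Ideal.Quotient.mk J)) ≫ f0) :
    ∃ f : Spec (.of (tripleRing J)) ⟶ Y,
      Spec.map (CommRingCat.ofHom (triplePr0 J)) ≫ f = f0 ∧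
      Spec.map (CommRingCat.ofHom (triplePr1 J)) ≫ f = f1 ∧
      Spec.map (CommRingCat.ofHom (triplePr2 J)) ≫ f = f2 := by
  obtain ⟨φ0, hφ0⟩ := Spec.map_surjective (f0 ≫ Y.isoSpec.hom)
  obtain ⟨φ1, hφ1⟩ := Spec.map_surjective (f1 ≫ Y.isoSpec.hom)
  obtain ⟨φ2, hφ2⟩ := Spec.map_surjective (f2 ≫ Y.isoSpec.hom)
  have aux : ∀ (φ : Γ(Y, ⊤) ⟶ .of R) (f : Spec (.of R) ⟶ Y),
      Spec.map φ = f ≫ Y.isoSpec.hom →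
      Spec.map (CommRingCat.ofHom (Ideal.Quotient.mk J)) ≫ f =
        Spec.map (CommRingCat.ofHom (Ideal.Quotient.mk J)) ≫ f0 →
      ∀ b, φ.hom b - φ0.hom b ∈ J := by
    intro φ f hφ hf b
    have : Spec.map (CommRingCat.ofHom (Ideal.Quotient.mk J)) ≫ Spec.map φ =
        Spec.map (CommRingCat.ofHom (Ideal.Quotient.mk J)) ≫ Spec.map φ0 := by
      rw [hφ, hφ0, ← Category.assoc, hf, Category.assoc]
    rw [← Spec.map_comp, ← Spec.map_comp] at this
    exact (Ideal.Quotient.eq (I := J)).1 congr($(Spec.map_injective this).hom b)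
  let Φ : Γ(Y, ⊤) →+* tripleRing J :=
    (φ0.hom.prod (φ1.hom.prod φ2.hom)).codRestrict (tripleRing J)
      fun b ↦ ⟨aux φ1 f1 hφ1 h1 b, aux φ2 f2 hφ2 h2 b⟩
  refine ⟨Spec.map (CommRingCat.ofHom Φ) ≫ Y.isoSpec.inv, ?_, ?_, ?_⟩
  all_goals
    rw [← Category.assoc, Iso.comp_inv_eq, ← Spec.map_comp]
  · rw [← hφ0]; rfl
  · rw [← hφ1]; rfl
  · rw [← hφ2]; rfl

variable {B : Scheme.{u}} [IsAffine B] (G : Over B) [GrpObj G] [IsAffine G.left]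

lemma mul_comm_of_square_zero (hJ : ∀ a ∈ J, ∀ b ∈ J, a * b = 0) (p : Spec (.of R) ⟶ B)
    (x y : Over.mk p ⟶ G)
    (hx : Spec.map (CommRingCat.ofHom (Ideal.Quotient.mk J)) ≫ x.left =
      Spec.map (CommRingCat.ofHom (Ideal.Quotient.mk J)) ≫ (1 : Over.mk p ⟶ G).left)
    (hy : Spec.map (CommRingCat.ofHom (Ideal.Quotient.mk J)) ≫ y.left =
      Spec.map (CommRingCat.ofHom (Ideal.Quotient.mk J)) ≫ (1 : Over.mk p ⟶ G).left) :
    x * y = y * x := by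
  set e : Over.mk p ⟶ G := 1 with he
  let δ := Spec.map (CommRingCat.ofHom (tripleDiag J))
  let T : Over B := Over.mk (δ ≫ p)
  have hid : ∀ r : tripleRing J →+* R, r.comp (tripleDiag J) = RingHom.id R →
      Spec.map (CommRingCat.ofHom r) ≫ δ ≫ p = p := by
    intro r hr
    rw [← Category.assoc, ← Spec.map_comp, ← CommRingCat.ofHom_comp, hr]
    exact (congrArg (· ≫ p) (Spec.map_id _)).trans (Category.id_comp p)
  let P0 : Over.mk p ⟶ T := Over.homMk (Spec.map (CommRingCat.ofHom (triplePr0 J)))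
    (hid _ rfl)
  let P1 : Over.mk p ⟶ T := Over.homMk (Spec.map (CommRingCat.ofHom (triplePr1 J)))
    (hid _ rfl)
  let P2 : Over.mk p ⟶ T := Over.homMk (Spec.map (CommRingCat.ofHom (triplePr2 J)))
    (hid _ rfl)
  let Sg : Over.mk p ⟶ T := Over.homMk (Spec.map (CommRingCat.ofHom (tripleSum J hJ)))
    (hid _ (by ext r; simp [tripleSum, tripleDiag]))
  -- morphisms out of `T` are detected by the three projections
  have hext : ∀ {Y : Over B} [IsAffine Y.left] {f g : T ⟶ Y}, P0 ≫ f = P0 ≫ g →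
      P1 ≫ f = P1 ≫ g → P2 ≫ f = P2 ≫ g → f = g := by
    intro Y _ f g h0 h1 h2
    apply Over.OverMorphism.ext
    exact triple_ext J congr(($h0).left) congr(($h1).left) congr(($h2).left)
  have hex : ∀ f1 f2 : Over.mk p ⟶ G,
      Spec.map (CommRingCat.ofHom (Ideal.Quotient.mk J)) ≫ f1.left =
        Spec.map (CommRingCat.ofHom (Ideal.Quotient.mk J)) ≫ e.left →
      Spec.map (CommRingCat.ofHom (Ideal.Quotient.mk J)) ≫ f2.left =
        Spec.map (CommRingCat.ofHom (Ideal.Quotient.mk J)) ≫ e.left →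
      ∃ f : T ⟶ G, P0 ≫ f = e ∧ P1 ≫ f = f1 ∧ P2 ≫ f = f2 := by
    intro f1 f2 h1 h2
    obtain ⟨f, g0, g1, g2⟩ := triple_exists J e.left f1.left f2.left h1 h2
    have w : f ≫ G.hom = δ ≫ p := by
      apply triple_ext J
      · rw [hid _ rfl, reassoc_of% g0]; exact Over.w e
      · rw [hid _ rfl, reassoc_of% g1]; exact Over.w f1
      · rw [hid _ rfl, reassoc_of% g2]; exact Over.w f2
    exact ⟨Over.homMk f w, Over.OverMorphism.ext g0, Over.OverMorphism.ext g1,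
      Over.OverMorphism.ext g2⟩
  obtain ⟨z1, a0, a1, a2⟩ := hex x e hx rfl
  obtain ⟨z2, b0, b1, b2⟩ := hex e y rfl hy
  have hz : z1 * z2 = z2 * z1 := by
    apply hext <;> simp only [MonObj.comp_mul, a0, a1, a2, b0, b1, b2, he, mul_one, one_mul]
  -- the sum map sends `(e, x, e)` to `x` and `(e, e, y)` to `y`
  have aux : ∀ (f : T ⟶ G) (g : Over.mk p ⟶ G),
      (P0 ≫ f = e ∧ P1 ≫ f = g ∧ P2 ≫ f = e) ∨ (P0 ≫ f = e ∧ P1 ≫ f = e ∧ P2 ≫ f = g) →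
      Sg ≫ f = g := by
    intro f g hfg
    apply Over.OverMorphism.ext
    rw [← cancel_mono G.left.isoSpec.hom]
    obtain ⟨φ, hφ⟩ := Spec.map_surjective (f.left ≫ G.left.isoSpec.hom)
    obtain ⟨τ, hτ⟩ := Spec.map_surjective (g.left ≫ G.left.isoSpec.hom)
    obtain ⟨ε, hε⟩ := Spec.map_surjective (e.left ≫ G.left.isoSpec.hom)
    have tr : ∀ (r : tripleRing J →+* R) (Pr : Over.mk p ⟶ T) (u : Over.mk p ⟶ G)
        (ν : Γ(G.left, ⊤) ⟶ .of R), Pr.left = Spec.map (CommRingCat.ofHom r) →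
        Spec.map ν = u.left ≫ G.left.isoSpec.hom → Pr ≫ f = u →
        ∀ b, r (φ.hom b) = ν.hom b := by
      intro r Pr u ν hr hν hu b
      have : Spec.map (CommRingCat.ofHom r) ≫ Spec.map φ = Spec.map ν := by
        rw [hφ, hν, ← hr, ← hu, Over.comp_left, Category.assoc]
      rw [← Spec.map_comp] at this
      exact congr($(Spec.map_injective this).hom b)
    rw [Over.comp_left, Category.assoc, ← hφ, ← hτ]
    change Spec.map (CommRingCat.ofHom (tripleSum J hJ)) ≫ _ = _
    rw [← Spec.map_comp]
    congr 1
    refine CommRingCat.hom_ext (RingHom.ext fun b ↦ ?_)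
    change triplePr1 J (φ.hom b) + triplePr2 J (φ.hom b) - triplePr0 J (φ.hom b) = τ.hom b
    rcases hfg with ⟨c0, c1, c2⟩ | ⟨c0, c1, c2⟩
    · rw [tr _ P0 e ε rfl hε c0, tr _ P1 g τ rfl hτ c1, tr _ P2 e ε rfl hε c2]; ring
    · rw [tr _ P0 e ε rfl hε c0, tr _ P1 e ε rfl hε c1, tr _ P2 g τ rfl hτ c2]; ring
  have := congrArg (Sg ≫ ·) hz
  simp only [MonObj.comp_mul, aux z1 x (.inl ⟨a0, a1, a2⟩), aux z2 y (.inr ⟨b0, b1, b2⟩)] at this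
  exact this

end Comm

section Kernel

variable {k I : Type u} [CommRing k] [AddCommGroup I] [Module k I] [Module kᵐᵒᵖ I]
  [IsCentralScalar k I]

/-- Over `k[I]`, the points of an affine group scheme with trivial restriction along `i`
commute with each other. -/
lemma mul_comm_of_restriction_eq_one (G : Over (SI k I)) [GrpObj G] [IsAffine G.left]
    {X : Over (SI k I)} (x y : X ⟶ G) (hx : (iPull k I).map x = 1)
    (hy : (iPull k I).map y = 1) : x * y = y * x := by
  apply Over.OverMorphism.ext
  refine Scheme.Cover.hom_ext X.left.affineOpenCover.openCover _ _ fun j ↦ ?_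
  let R : Type u := X.left.affineOpenCover.X j
  let f : Spec (.of R) ⟶ X.left := X.left.affineOpenCover.f j
  obtain ⟨φ, hφ⟩ := Spec.map_surjective (f ≫ X.hom)
  let F : Over.mk (f ≫ X.hom) ⟶ X := Over.homMk f
  let J : Ideal R := (RingHom.ker (TrivSqZeroExt.fstHom k k I).toRingHom).map φ.hom
  have hJ : ∀ a ∈ J, ∀ b ∈ J, a * b = 0 := by
    intro a ha b hb
    have h2 : J * J = ⊥ := by
      rw [← Ideal.map_mul, Ideal.map_eq_bot_iff_le_ker, Ideal.mul_le]
      intro r hr s hs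
      have : r * s = 0 := by
        ext
        · simp_all [RingHom.mem_ker]
        · simp_all [RingHom.mem_ker]
      rw [this]; exact Ideal.zero_mem _
    have := Ideal.mul_mem_mul ha hb
    rwa [h2] at this
  let q : Spec (.of (R ⧸ J)) ⟶ Spec (.of R) := Spec.map (CommRingCat.ofHom (Ideal.Quotient.mk J))
  let m : Spec (.of (R ⧸ J)) ⟶ S k := Spec.map (CommRingCat.ofHom
    (((Ideal.Quotient.mk J).comp φ.hom).comp (algebraMap k (TrivSqZeroExt k I))))
  have hm : (q ≫ f) ≫ X.hom = m ≫ i k I := by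
    rw [Category.assoc, ← hφ, i, ← Spec.map_comp, ← Spec.map_comp]
    congr 1
    refine CommRingCat.hom_ext (RingHom.ext fun r ↦ ?_)
    change Ideal.Quotient.mk J (φ.hom r) =
      Ideal.Quotient.mk J (φ.hom (algebraMap k (TrivSqZeroExt k I) (TrivSqZeroExt.fst r)))
    rw [Ideal.Quotient.eq, ← map_sub]
    apply Ideal.mem_map_of_mem
    simp [RingHom.mem_ker, TrivSqZeroExt.algebraMap_eq_inl]
  have key : ∀ z : X ⟶ G, (iPull k I).map z = 1 →
      q ≫ (F ≫ z).left = q ≫ (1 : Over.mk (f ≫ X.hom) ⟶ G).left := by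
    intro z hz
    have h1 : ∀ w : X ⟶ G, q ≫ (F ≫ w).left =
        pullback.lift (q ≫ f) m hm ≫ ((iPull k I).map w).left ≫ pullback.fst _ _ := by
      intro w
      change q ≫ f ≫ w.left = pullback.lift (q ≫ f) m hm ≫
        pullback.lift (pullback.fst X.hom (i k I) ≫ w.left) (pullback.snd X.hom (i k I)) _ ≫
          pullback.fst G.hom (i k I)
      rw [pullback.lift_fst, pullback.lift_fst_assoc, Category.assoc]
    rw [← MonObj.comp_one F, h1, h1, hz, Functor.map_one]
  have := mul_comm_of_square_zero J G hJ (f ≫ X.hom) (F ≫ x) (F ≫ y) (key x hx) (key y hy)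
  rw [← MonObj.comp_mul, ← MonObj.comp_mul] at this
  exact congr(($this).left)

end Kernel

section Lie

variable {k : Type u} (I : Type u) [CommRing k] [AddCommGroup I] [Module k I] [Module kᵐᵒᵖ I]
  [IsCentralScalar k I] (G : Over (S k)) [GrpObj G]

/-- The `T`-points of the tangent bundle `T(G,I) = h_* h^* G`, that is, the group of
`k[I]`-morphisms `h^* T ⟶ h^* G`, where `h^* G` carries the base-changed group structure. -/
abbrev Tangent (T : Over (S k)) : Type u := (hPull k I).obj T ⟶ (hPull k I).obj G

/-- The inclusion `α : G ⟶ T(G,I)` on `T`-points. -/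
abbrev tangentZero {T : Over (S k)} (g : T ⟶ G) : Tangent I G T := (hPull k I).map g

/-- The `T`-points of the kernel of `T(G,I) ⟶ G`; the latter map sends `x : h^* T ⟶ h^* G` to
its restriction `i^* x`, viewed as a map `T ⟶ G` through `i^* h^* ≅ id`. -/
def lieSubgroup (T : Over (S k)) : Subgroup (Tangent I G T) :=
  ((iPull k I).homMonoidHom (X := (hPull k I).obj T) (M := (hPull k I).obj G)).ker

/-- The `T`-points of `Lie(G,I)`, the kernel of `T(G,I) ⟶ G`, written additively. -/
def Lie (T : Over (S k)) : Type u := Additive (lieSubgroup I G T)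

variable {I G}

/-- The inclusion `Lie(G,I) ⟶ T(G,I)` on `T`-points, usually written `x ↦ 1 + x`. -/
def Lie.toTangent {T : Over (S k)} (x : Lie I G T) : Tangent I G T := (Additive.toMul x).1

lemma Lie.toTangent_mem {T : Over (S k)} (x : Lie I G T) :
    (iPull k I).map x.toTangent = 1 := (Additive.toMul x).2

/-- A `T`-point of `T(G,I)` in the kernel of `T(G,I) ⟶ G`, as a point of `Lie(G,I)`. -/
def Lie.mk {T : Over (S k)} (x : Tangent I G T) (hx : (iPull k I).map x = 1) : Lie I G T :=
  Additive.ofMul ⟨x, hx⟩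

@[simp] lemma Lie.toTangent_mk {T : Over (S k)} (x : Tangent I G T)
    (hx : (iPull k I).map x = 1) : (Lie.mk x hx).toTangent = x := rfl

@[ext] lemma Lie.ext {T : Over (S k)} {x y : Lie I G T} (hxy : x.toTangent = y.toTangent) :
    x = y := congrArg Additive.ofMul (Subtype.ext hxy)

variable [IsAffine G.left]

instance isAffine_hPull_left : IsAffine ((hPull k I).obj G).left :=
  inferInstanceAs (IsAffine (pullback G.hom (h k I)))

instance Lie.instAddCommGroup (T : Over (S k)) : AddCommGroup (Lie I G T) :=
  { (inferInstance : AddGroup (Additive (lieSubgroup I G T))) with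
    add_comm := fun x y ↦ Lie.ext <|
      mul_comm_of_restriction_eq_one ((hPull k I).obj G) _ _ x.toTangent_mem y.toTangent_mem }

@[simp] lemma Lie.toTangent_add {T : Over (S k)} (x y : Lie I G T) :
    (x + y).toTangent = x.toTangent * y.toTangent := rfl

@[simp] lemma Lie.toTangent_zero {T : Over (S k)} :
    (0 : Lie I G T).toTangent = 1 := rfl

@[simp] lemma Lie.toTangent_neg {T : Over (S k)} (x : Lie I G T) :
    (-x).toTangent = x.toTangent⁻¹ := rfl

/-- The functoriality of `Lie(G,I)` in the test scheme. -/
def Lie.restrict {T T' : Over (S k)} (f : T' ⟶ T) : Lie I G T →+ Lie I G T' where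
  toFun x := Lie.mk ((hPull k I).map f ≫ x.toTangent)
    (by rw [Functor.map_comp, x.toTangent_mem, MonObj.comp_one])
  map_zero' := Lie.ext (MonObj.comp_one _)
  map_add' x y := Lie.ext (MonObj.comp_mul _ _ _)

/-- The adjoint action of `G` on `Lie(G,I)`: conjugation inside `T(G,I)`. -/
def Ad {T : Over (S k)} (g : T ⟶ G) : Lie I G T →+ Lie I G T where
  toFun x := Lie.mk (tangentZero I G g * x.toTangent * (tangentZero I G g)⁻¹) (by
    have : ((iPull k I).homMonoidHom (tangentZero I G g * x.toTangent * (tangentZero I G g)⁻¹)) =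
        1 := by
      have hx : (iPull k I).homMonoidHom x.toTangent = 1 := x.toTangent_mem
      rw [map_mul, map_mul, hx, mul_one, ← map_mul, mul_inv_cancel, map_one]
    exact this)
  map_zero' := Lie.ext (by simp)
  map_add' x y := Lie.ext (by
    change tangentZero I G g * (x.toTangent * y.toTangent) * (tangentZero I G g)⁻¹ =
      (tangentZero I G g * x.toTangent * (tangentZero I G g)⁻¹) *
        (tangentZero I G g * y.toTangent * (tangentZero I G g)⁻¹)
    group)

lemma Lie.toTangent_restrict {T T' : Over (S k)} (f : T' ⟶ T) (x : Lie I G T) :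
    (Lie.restrict f x).toTangent = (hPull k I).map f ≫ x.toTangent := rfl

lemma toTangent_Ad {T : Over (S k)} (g : T ⟶ G) (x : Lie I G T) :
    (Ad g x).toTangent = tangentZero I G g * x.toTangent * (tangentZero I G g)⁻¹ := rfl

lemma Lie.restrict_restrict {T T' T'' : Over (S k)} (f : T' ⟶ T) (g : T'' ⟶ T') (x : Lie I G T) :
    Lie.restrict g (Lie.restrict f x) = Lie.restrict (g ≫ f) x :=
  Lie.ext (by simp only [Lie.toTangent_restrict, Functor.map_comp, Category.assoc])

lemma Lie.restrict_Ad {T T' : Over (S k)} (f : T' ⟶ T) (g : T ⟶ G) (x : Lie I G T) :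
    Lie.restrict f (Ad g x) = Ad (f ≫ g) (Lie.restrict f x) :=
  Lie.ext (by
    simp only [Lie.toTangent_restrict, toTangent_Ad, MonObj.comp_mul, GrpObj.comp_inv,
      Functor.map_comp])

lemma Ad_mul {T : Over (S k)} (g g' : T ⟶ G) (x : Lie I G T) :
    Ad (g * g') x = Ad g (Ad g' x) :=
  Lie.ext (by simp only [toTangent_Ad, Functor.map_mul, mul_inv_rev, _root_.mul_assoc])

end Lie

section Cohomology

variable {k : Type u} (I : Type u) [CommRing k] [AddCommGroup I] [Module k I] [Module kᵐᵒᵖ I]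
  [IsCentralScalar k I] (G : Over (S k)) [GrpObj G]

/-- Morphisms `G ⟶ Lie(G,I)`: by the Yoneda lemma, these are the `G`-points of `Lie(G,I)`. -/
abbrev C1 : Type u := Lie I G G

/-- Morphisms `G × G ⟶ Lie(G,I)`: by the Yoneda lemma, these are the `G × G`-points of
`Lie(G,I)`. -/
abbrev C2 : Type u := Lie I G (G ⊗ G)

variable {I G} [IsAffine G.left]

/-- The value `ψ(u)` of a morphism `ψ : G ⟶ Lie(G,I)` at a `T`-point `u` of `G`. -/
def C1.eval (ψ : C1 I G) {T : Over (S k)} (u : T ⟶ G) : Lie I G T := Lie.restrict u ψ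

/-- The value `c(u,v)` of a morphism `c : G × G ⟶ Lie(G,I)` at `T`-points `u`, `v` of `G`. -/
def C2.eval (c : C2 I G) {T : Over (S k)} (u v : T ⟶ G) : Lie I G T := Lie.restrict (lift u v) c

variable (I G)

/-- The group of `2`-cocycles `G × G ⟶ Lie(G,I)` for the adjoint action. -/
def Z2 : AddSubgroup (C2 I G) where
  carrier := {c | ∀ (T : Over (S k)) (u v w : T ⟶ G),
    C2.eval c u v + C2.eval c (u * v) w = Ad u (C2.eval c v w) + C2.eval c u (v * w)}
  zero_mem' T u v w := by simp [C2.eval]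
  add_mem' {c c'} hc hc' T u v w := by
    have h1 := hc T u v w
    have h2 := hc' T u v w
    simp only [C2.eval, map_add] at *
    rw [add_add_add_comm, h1, h2, add_add_add_comm]
  neg_mem' {c} hc T u v w := by
    have h1 := hc T u v w
    simp only [C2.eval, map_neg] at *
    rw [← neg_add, h1, neg_add]

/-- The coboundary of `ψ : G ⟶ Lie(G,I)`, that is the morphism
`(u, v) ↦ Ad(u) ψ(v) - ψ(uv) + ψ(u)`. -/
def coboundary : C1 I G →+ C2 I G where
  toFun ψ := Ad (fst G G) (C1.eval ψ (snd G G)) - C1.eval ψ (fst G G * snd G G) +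
    C1.eval ψ (fst G G)
  map_zero' := by simp [C1.eval]
  map_add' ψ ψ' := by simp only [C1.eval, map_add]; abel

/-- The group of `2`-coboundaries. -/
def B2 : AddSubgroup (C2 I G) := (coboundary I G).range

/-- The second (Hochschild) cohomology group `H²(G, Lie(G,I))` for the adjoint action:
`2`-cocycles modulo `2`-coboundaries. -/
abbrev H2 : Type u := Z2 I G ⧸ (B2 I G).addSubgroupOf (Z2 I G)

variable {I G}

lemma coboundary_eval (ψ : C1 I G) {T : Over (S k)} (u v : T ⟶ G) :
    C2.eval (coboundary I G ψ) u v =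
      Ad u (C1.eval ψ v) - C1.eval ψ (u * v) + C1.eval ψ u := by
  simp only [C2.eval, C1.eval, coboundary, AddMonoidHom.coe_mk, ZeroHom.coe_mk, map_add, map_sub,
    Lie.restrict_Ad, Lie.restrict_restrict, MonObj.comp_mul, lift_fst, lift_snd]

lemma B2_le_Z2 : B2 I G ≤ Z2 I G := by
  rintro _ ⟨ψ, rfl⟩ T u v w
  simp only [coboundary_eval, map_add, map_sub, ← Ad_mul, _root_.mul_assoc]
  abel

end Cohomology

section Deformations

variable {k : Type u} (I : Type u) [CommRing k] [AddCommGroup I] [Module k I] [Module kᵐᵒᵖ I]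
  [IsCentralScalar k I] (G : Over (S k)) [GrpObj G]

variable {I G} in
/-- For a group structure `grp` on the `k[I]`-scheme `X`, the morphism `e : i^* X ⟶ G` is a
homomorphism of `k`-group schemes, where `i^* X` carries the restriction of `grp`. -/
def IsSpecialFibreHom {X : Over (SI k I)} (grp : GrpObj X) (e : (iPull k I).obj X ⟶ G) : Prop :=
  IsMonHom e

/-- A `k[I]`-group scheme structure on the `k[I]`-scheme `h^* G` lifting the group structure of
`G`: the canonical isomorphism `i^* h^* G ≅ G` is an isomorphism of `k`-group schemes, where
`i^* h^* G` carries the restriction of the given structure. -/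
structure LiftedGroupStructure where
  grp : GrpObj ((hPull k I).obj G)
  lifts : IsSpecialFibreHom grp (specialFibre k I G).hom

/-- A deformation of `G` over `k[I]`: a `k[I]`-group scheme, flat if `G` is flat, together with an
isomorphism of `k`-group schemes between its special fibre and `G`. -/
structure Deformation where
  X : Over (SI k I)
  [grp : GrpObj X]
  e : (iPull k I).obj X ≅ G
  [isMonHom_e : IsMonHom e.hom]
  flat : Flat G.hom → Flat X.hom

attribute [instance] Deformation.grp Deformation.isMonHom_e

variable {I G}

/-- A `k[I]`-scheme is rigid if there is an isomorphism of `k[I]`-schemes `h^* i^* X ≅ X`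
(a rigidification) lifting the identity of the special fibre `i^* X`. -/
def IsRigid (X : Over (SI k I)) : Prop :=
  ∃ σ : (hPull k I).obj ((iPull k I).obj X) ≅ X,
    (iPull k I).map σ.hom = (specialFibre k I ((iPull k I).obj X)).hom

variable (I G)

/-- The rigid deformations of `G` over `k[I]`. -/
abbrev RigidDeformation : Type (u + 1) := {D : Deformation I G // IsRigid D.X}

/-- Two deformations are isomorphic if there is an isomorphism of `k[I]`-group schemes between
them that is compatible with the identifications of the special fibres with `G`. -/
instance RigidDeformation.setoid : Setoid (RigidDeformation I G) where
  r D D' := ∃ f : D.1.X ≅ D'.1.X, IsMonHom f.hom ∧ (iPull k I).map f.hom ≫ D'.1.e.hom = D.1.e.hom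
  iseqv := by
    refine ⟨fun D ↦ ⟨Iso.refl _, ?_, by simp⟩, ?_, ?_⟩
    · dsimp; infer_instance
    · rintro D D' ⟨f, hf, hf'⟩
      refine ⟨f.symm, ?_, ?_⟩
      · dsimp; infer_instance
      · rw [← hf', ← Category.assoc, ← Functor.map_comp]; simp
    · rintro D D' D'' ⟨f, hf, hf'⟩ ⟨g, hg, hg'⟩
      refine ⟨f ≪≫ g, ?_, ?_⟩
      · dsimp; infer_instance
      · rw [Iso.trans_hom, Functor.map_comp, Category.assoc, hg', hf']

/-- The set of isomorphism classes of rigid deformations of `G` over `k[I]`. -/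
abbrev RigidDeformationClass : Type (u + 1) := Quotient (RigidDeformation.setoid I G)

variable {I G}

/-- The rigid deformation of `G` given by the scheme `h^* G` with a group structure lifting that
of `G`. -/
def LiftedGroupStructure.toRigidDeformation (s : LiftedGroupStructure I G) :
    RigidDeformation I G :=
  ⟨{ X := (hPull k I).obj G
     grp := s.grp
     e := specialFibre k I G
     isMonHom_e := s.lifts
     flat := fun _ ↦ inferInstanceAs (Flat (pullback.snd G.hom (h k I))) },
    ⟨(hPull k I).mapIso (specialFibre k I G), by
      rw [Functor.mapIso_hom, ← cancel_mono (specialFibre k I G).hom]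
      exact specialFibre_natural k I (specialFibre k I G).hom⟩⟩

end Deformations

end GroupDeformation

end

noncomputable section

/-! In coordinates, a morphism to an affine `k[I]`-group scheme that is trivial on the special fibre
is the unit plus a term with coefficients in `I`. Since `I² = 0`, composing it with a point `x` only
sees the special fibre of `x` (`comp_eq_comp_of_iPull_map_eq_one`). A morphism `c : G × G →
Lie(G,I)` can therefore be evaluated at points of `h^* G` over any `k[I]`-scheme (`C2.value`), and
its values do not change when the arguments are multiplied by infinitesimal factors
(`C2.value_congr`).

A multiplication on `h^* G` lifting that of `G` differs from the base-changed one by a unique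
infinitesimal factor, so it has the form `(x, y) ↦ (1 + c(x,y)) x y`. In the associativity law the
infinitesimal factors drop out of the arguments of `c`. Cancelling `xyz` leaves the cocycle identity
(`mem_Z2_iff_twistedMul_assoc`), and a unit and inverses then exist automatically. This is (1).

For (2), a rigidification transports the group structure of a deformation to `h^* G`
(`exists_toRigidDeformation_equiv`). An isomorphism from `𝒢_c` to `𝒢_c'` over the identity of `G`
has the form `x ↦ (1 + ψ(x)) x`, and such a map is a homomorphism exactly when `c - c'` is the
coboundary of `ψ` (`isMonHom_iff_sub_eq_coboundary`). -/

namespace GroupDeformation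

/-! ### Morphisms over `k[I]` and their special fibres -/

section SpecialFibre

variable {k I : Type u} [CommRing k] [AddCommGroup I] [Module k I] [Module kᵐᵒᵖ I]
  [IsCentralScalar k I]

variable (k I) in
/-- The ideal `I` of `k[I]`. -/
abbrev thickeningIdeal : Ideal (TrivSqZeroExt k I) :=
  RingHom.ker (TrivSqZeroExt.fstHom k k I).toRingHom

lemma mul_eq_zero_of_mem_thickeningIdeal {r s : TrivSqZeroExt k I}
    (hr : r ∈ thickeningIdeal k I) (hs : s ∈ thickeningIdeal k I) : r * s = 0 := by
  ext <;> simp_all [RingHom.mem_ker]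

/-- Morphisms with the same special fibre agree, on an affine chart `Spec R`, modulo `I R`. -/
lemma comp_eq_comp_of_iPull_map_eq {X Z : Over (SI k I)} {z w : X ⟶ Z}
    (hzw : (iPull k I).map z = (iPull k I).map w) {R : CommRingCat.{u}}
    (f : Spec R ⟶ X.left) (φ : CommRingCat.of (TrivSqZeroExt k I) ⟶ R)
    (hφ : Spec.map φ = f ≫ X.hom) :
    Spec.map (CommRingCat.ofHom (Ideal.Quotient.mk ((thickeningIdeal k I).map φ.hom))) ≫
        f ≫ z.left =
      Spec.map (CommRingCat.ofHom (Ideal.Quotient.mk ((thickeningIdeal k I).map φ.hom))) ≫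
        f ≫ w.left := by
  set J : Ideal R := (thickeningIdeal k I).map φ.hom
  let q : Spec (.of (R ⧸ J)) ⟶ Spec R := Spec.map (CommRingCat.ofHom (Ideal.Quotient.mk J))
  let m : Spec (.of (R ⧸ J)) ⟶ S k := Spec.map (CommRingCat.ofHom
    (((Ideal.Quotient.mk J).comp φ.hom).comp (algebraMap k (TrivSqZeroExt k I))))
  -- Since `J` is generated by the image of `I`, the map `Spec (R/J) → Spec k[I]` factors through
  -- `i`. Hence `q ≫ f` factors through the special fibre of `X`, where `z` and `w` agree.
  have hm : (q ≫ f) ≫ X.hom = m ≫ i k I := by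
    rw [Category.assoc, ← hφ, i, ← Spec.map_comp, ← Spec.map_comp]
    congr 1
    refine CommRingCat.hom_ext (RingHom.ext fun r ↦ ?_)
    change Ideal.Quotient.mk J (φ.hom (r : TrivSqZeroExt k I)) =
      Ideal.Quotient.mk J (φ.hom (algebraMap k (TrivSqZeroExt k I) (TrivSqZeroExt.fst r)))
    rw [Ideal.Quotient.eq, ← map_sub]
    apply Ideal.mem_map_of_mem
    simp [RingHom.mem_ker, TrivSqZeroExt.algebraMap_eq_inl]
  have h1 : ∀ w : X ⟶ Z, q ≫ f ≫ w.left =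
      pullback.lift (q ≫ f) m hm ≫ ((iPull k I).map w).left ≫ pullback.fst _ _ := by
    intro w
    change _ = pullback.lift (q ≫ f) m hm ≫
      pullback.lift (pullback.fst X.hom (i k I) ≫ w.left) (pullback.snd X.hom (i k I)) _ ≫
        pullback.fst Z.hom (i k I)
    rw [pullback.lift_fst, pullback.lift_fst_assoc, Category.assoc]
  change q ≫ f ≫ z.left = q ≫ f ≫ w.left
  rw [h1, h1, hzw]

/-- If `K² = 0`, two `A`-algebra maps `ξ`, `ξ'` that agree modulo `K` take the same values on the
differences `ζ b - θ b` of two ring maps that agree modulo `K`. -/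
lemma apply_sub_apply_eq_of_square_zero {A B C D : Type*} [CommRing A] [CommRing B] [CommRing C]
    [CommRing D] {K : Ideal A} (hK : ∀ r ∈ K, ∀ s ∈ K, r * s = 0) {τ : A →+* C} {ρ : A →+* D}
    {ζ θ : B →+* C} (hζ : ∀ b, ζ b - θ b ∈ K.map τ) {ξ ξ' : C →+* D}
    (hξ : ∀ c, ξ c - ξ' c ∈ K.map ρ) (h1 : ξ.comp τ = ρ) (h2 : ξ'.comp τ = ρ) (b : B) :
    ξ (ζ b - θ b) = ξ' (ζ b - θ b) := by
  have hmul : ∀ s ∈ K, ∀ d ∈ K.map ρ, ρ s * d = 0 := by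
    intro s hs d hd
    induction hd using Submodule.span_induction with
    | mem d hd =>
      obtain ⟨r, hr, rfl⟩ := hd
      rw [← map_mul, hK s hs r hr, map_zero]
    | zero => simp
    | add x y _ _ hx hy => rw [mul_add, hx, hy, add_zero]
    | smul a x _ hx => rw [smul_eq_mul, mul_left_comm, hx, mul_zero]
  have hb := hζ b
  generalize ζ b - θ b = d at hb ⊢
  induction hb using Submodule.span_induction with
  | mem c hc =>
    obtain ⟨r, hr, rfl⟩ := hc
    exact congr($(h1.trans h2.symm) r)
  | zero => simp
  | add x y _ _ hx hy => rw [map_add, map_add, hx, hy]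
  -- Here `ξ(ax) - ξ'(ax) = (ξ a - ξ' a) ξ x`, a product of two elements of the extension of `K`
  -- along `ρ`, which vanishes because `K² = 0`.
  | smul a x hx' hx =>
    rw [smul_eq_mul, map_mul, map_mul, ← hx, ← sub_eq_zero, ← sub_mul]
    have key : ∀ x ∈ K.map τ, ∀ d ∈ K.map ρ, ξ x * d = 0 := by
      intro x hx d hd
      induction hx using Submodule.span_induction with
      | mem c hc =>
        obtain ⟨r, hr, rfl⟩ := hc
        rw [← RingHom.comp_apply, h1, hmul r hr d hd]
      | zero => simp
      | add x y _ _ hx hy => rw [map_add, add_mul, hx, hy, add_zero]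
      | smul a x _ hx => rw [smul_eq_mul, map_mul, mul_assoc, hx, mul_zero]
    rw [mul_comm, key x hx' _ (hξ a)]

/-- `comp_eq_comp_of_iPull_map_eq_one` on an affine chart `Spec R`. -/
lemma comp_left_comp_left_eq_of_iPull_map_eq_one {X Y Z : Over (SI k I)} [IsAffine Y.left]
    [IsAffine Z.left] [GrpObj Z] {x x' : X ⟶ Y} (hx : (iPull k I).map x = (iPull k I).map x')
    {z : Y ⟶ Z} (hz : (iPull k I).map z = 1) {R : CommRingCat.{u}} (f : Spec R ⟶ X.left) :
    f ≫ x.left ≫ z.left = f ≫ x'.left ≫ z.left := by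
  obtain ⟨φ, hφ⟩ := Spec.map_surjective (f ≫ X.hom)
  obtain ⟨ψ, hψ⟩ := Spec.map_surjective (Y.left.isoSpec.inv ≫ Y.hom)
  have hz' : (iPull k I).map z = (iPull k I).map 1 := by rw [hz, Functor.map_one]
  have c1 := comp_eq_comp_of_iPull_map_eq hx f φ hφ
  have c2 := comp_eq_comp_of_iPull_map_eq hz' _ ψ hψ
  obtain ⟨ξ, hξ⟩ := Spec.map_surjective (f ≫ x.left ≫ Y.left.isoSpec.hom)
  obtain ⟨ξ', hξ'⟩ := Spec.map_surjective (f ≫ x'.left ≫ Y.left.isoSpec.hom)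
  obtain ⟨ζ, hζ⟩ := Spec.map_surjective (Y.left.isoSpec.inv ≫ z.left ≫ Z.left.isoSpec.hom)
  obtain ⟨θ, hθ⟩ := Spec.map_surjective
    (Y.left.isoSpec.inv ≫ (1 : Y ⟶ Z).left ≫ Z.left.isoSpec.hom)
  have e : ∀ y : X ⟶ Y, f ≫ y.left ≫ (1 : Y ⟶ Z).left = f ≫ (1 : X ⟶ Z).left := fun y ↦ by
    rw [← Over.comp_left, MonObj.comp_one]
  have h1 : ψ ≫ ξ = φ := Spec.map_injective (by simp [hψ, hξ, hφ])
  have h2 : ψ ≫ ξ' = φ := Spec.map_injective (by simp [hψ, hξ', hφ])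
  -- The unit morphism is constant, so it cannot distinguish `x` from `x'`. Only the difference `ζ -
  -- θ`, with values in the extension of `I`, remains to be compared.
  have h3 : θ ≫ ξ = θ ≫ ξ' := Spec.map_injective (by
    simp [hθ, hξ, hξ', reassoc_of% (e x), reassoc_of% (e x')])
  have h4 : ζ ≫ ξ = ζ ≫ ξ' := by
    refine CommRingCat.hom_ext (RingHom.ext fun b ↦ ?_)
    have := apply_sub_apply_eq_of_square_zero (K := thickeningIdeal k I) (τ := ψ.hom)
      (ρ := φ.hom) (ζ := ζ.hom) (θ := θ.hom) (ξ := ξ.hom) (ξ' := ξ'.hom)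
      (fun r hr s hs ↦ mul_eq_zero_of_mem_thickeningIdeal hr hs) (fun b ↦ ?_) (fun c ↦ ?_)
      congr($(h1).hom) congr($(h2).hom) b
    · rw [map_sub, map_sub] at this
      have h5 : ξ.hom (θ.hom b) = ξ'.hom (θ.hom b) := congr($(h3).hom b)
      rw [h5] at this
      exact sub_left_injective this
    · rw [← Ideal.Quotient.eq]
      have : ζ ≫ CommRingCat.ofHom (Ideal.Quotient.mk ((thickeningIdeal k I).map ψ.hom)) =
          θ ≫ CommRingCat.ofHom (Ideal.Quotient.mk ((thickeningIdeal k I).map ψ.hom)) :=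
        Spec.map_injective (by
          rw [Spec.map_comp, Spec.map_comp, hζ, hθ]; simpa using c2 =≫ Z.left.isoSpec.hom)
      exact congr($(this).hom b)
    · rw [← Ideal.Quotient.eq]
      have : ξ ≫ CommRingCat.ofHom (Ideal.Quotient.mk ((thickeningIdeal k I).map φ.hom)) =
          ξ' ≫ CommRingCat.ofHom (Ideal.Quotient.mk ((thickeningIdeal k I).map φ.hom)) :=
        Spec.map_injective (by
          rw [Spec.map_comp, Spec.map_comp, hξ, hξ']; simpa using c1 =≫ Y.left.isoSpec.hom)
      exact congr($(this).hom c)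
  have h6 := congr(Spec.map $h4)
  rw [Spec.map_comp, Spec.map_comp, hξ, hξ', hζ] at h6
  simp only [Category.assoc, Iso.hom_inv_id_assoc] at h6
  simpa only [← Category.assoc, cancel_mono] using h6

/-- The composite of a point `x` with a morphism to an affine group scheme that is trivial on the
special fibre depends only on the special fibre of `x`. -/
lemma comp_eq_comp_of_iPull_map_eq_one {X Y Z : Over (SI k I)} [IsAffine Y.left]
    [IsAffine Z.left] [GrpObj Z] {x x' : X ⟶ Y} (hx : (iPull k I).map x = (iPull k I).map x')
    {z : Y ⟶ Z} (hz : (iPull k I).map z = 1) : x ≫ z = x' ≫ z := by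
  apply Over.OverMorphism.ext
  exact Scheme.Cover.hom_ext X.left.affineOpenCover.openCover _ _ fun j ↦
    comp_left_comp_left_eq_of_iPull_map_eq_one hx hz (X.left.affineOpenCover.f j)

end SpecialFibre

/-! ### Group objects and their homomorphisms through points -/

section CartesianMonoidal

variable {C : Type*} [Category C] [CartesianMonoidalCategory C]

/-- A group object structure from pointwise group axioms. -/
abbrev grpObjOfPointwise {X : C} (m : X ⊗ X ⟶ X) (e : 𝟙_ C ⟶ X) (n : X ⟶ X)
    (assoc : ∀ {T : C} (x y z : T ⟶ X),
      lift (lift x y ≫ m) z ≫ m = lift x (lift y z ≫ m) ≫ m)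
    (one_mul : ∀ {T : C} (x : T ⟶ X), lift (toUnit T ≫ e) x ≫ m = x)
    (mul_one : ∀ {T : C} (x : T ⟶ X), lift x (toUnit T ≫ e) ≫ m = x)
    (right_inv : lift (𝟙 X) n ≫ m = toUnit X ≫ e) : GrpObj X where
  one := e
  mul := m
  one_mul := by
    rw [leftUnitor_hom, ← one_mul (snd (𝟙_ C) X)]
    congr 1; ext <;> simp [toUnit_unique (fst (𝟙_ C) X) (toUnit _)]
  mul_one := by
    rw [rightUnitor_hom, ← mul_one (fst X (𝟙_ C))]
    congr 1; ext <;> simp [toUnit_unique (snd X (𝟙_ C)) (toUnit _)]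
  mul_assoc := by
    convert! assoc (fst (X ⊗ X) X ≫ fst X X) (fst (X ⊗ X) X ≫ snd X X) (snd (X ⊗ X) X) using 1
    · congr 1; ext <;> simp [← comp_lift]
    · rw [← Category.assoc]; congr 1; ext
      · simp
      · simp only [Category.assoc, whiskerLeft_snd, lift_snd]
        rw [← Category.assoc]; congr 1; ext <;> simp
  inv := n
  left_inv := by
    have hn : lift n (n ≫ n) ≫ m = toUnit X ≫ e := by
      have := congr(n ≫ $right_inv)
      simpa only [← Category.assoc, comp_lift, Category.comp_id, comp_toUnit] using this
    -- Writing `x'` for `n(x)`, this is `(x' x) x' = x'`. Multiplying on the right by a right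
    -- inverse of `x'` gives `x' x = 1`.
    have h1 : lift (lift n (𝟙 X) ≫ m) n ≫ m = n := by
      rw [assoc, right_inv, mul_one]
    have h2 := assoc (lift n (𝟙 X) ≫ m) n (n ≫ n)
    rw [h1, hn, mul_one] at h2
    exact h2.symm
  right_inv := right_inv

/-- A morphism of group objects compatible with the multiplications is compatible with the
units. -/
lemma isMonHom_of_mul {X Y : C} [GrpObj X] [GrpObj Y] (f : X ⟶ Y)
    (hf : μ[X] ≫ f = (f ⊗ₘ f) ≫ μ[Y]) : IsMonHom f where
  mul_hom := hf
  one_hom := by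
    -- The image of the unit is idempotent, and the only idempotent in a group is the identity.
    have h1 : (η[X] ≫ f) * (η[X] ≫ f) = η[X] ≫ f := by
      have h2 := congr(lift η[X] η[X] ≫ $hf)
      rw [lift_map_assoc, ← Category.assoc] at h2
      have h3 : lift η[X] η[X] ≫ μ[X] = η[X] := by
        rw [MonObj.one_eq_one]; exact mul_one (1 : 𝟙_ C ⟶ X)
      rw [h3] at h2
      exact h2.symm
    rw [MonObj.one_eq_one (M := Y)]
    exact mul_eq_left.1 h1

lemma isMonHom_iff_lift {X Y : C} [GrpObj X] [GrpObj Y] (f : X ⟶ Y) :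
    IsMonHom f ↔ ∀ (T : C) (x y : T ⟶ X), lift x y ≫ μ[X] ≫ f = lift (x ≫ f) (y ≫ f) ≫ μ[Y] := by
  refine ⟨fun _ T x y ↦ by simp, fun hf ↦ isMonHom_of_mul f ?_⟩
  have h1 := hf _ (fst X X) (snd X X)
  rw [lift_fst_snd, Category.id_comp] at h1
  rw [h1]
  congr 1
  ext <;> simp

end CartesianMonoidal

/-! ### Cocycles evaluated at arbitrary points of `h^* G` -/

section Cocycle

variable {k I : Type u} [CommRing k] [AddCommGroup I] [Module k I] [Module kᵐᵒᵖ I]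
  [IsCentralScalar k I] {G : Over (S k)} [GrpObj G]

lemma iPull_map_lift_congr {X Y Z : Over (SI k I)} {x x' : X ⟶ Y} {y y' : X ⟶ Z}
    (hx : (iPull k I).map x = (iPull k I).map x') (hy : (iPull k I).map y = (iPull k I).map y') :
    (iPull k I).map (lift x y) = (iPull k I).map (lift x' y') := by
  rw [← Functor.Monoidal.lift_μ, ← Functor.Monoidal.lift_μ, hx, hy]

/-- The value of `c : G × G ⟶ Lie(G,I)` at two `X`-points of `h^* G`, for a `k[I]`-scheme `X`. -/
def C2.value (c : C2 I G) {X : Over (SI k I)} (x y : X ⟶ (hPull k I).obj G) :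
    X ⟶ (hPull k I).obj G :=
  lift x y ≫ Functor.LaxMonoidal.μ (hPull k I) G G ≫ c.toTangent

lemma C2.comp_value (c : C2 I G) {X X' : Over (SI k I)} (f : X' ⟶ X)
    (x y : X ⟶ (hPull k I).obj G) : f ≫ c.value x y = c.value (f ≫ x) (f ≫ y) := by
  rw [C2.value, C2.value, ← Category.assoc, comp_lift]

lemma C2.iPull_map_value (c : C2 I G) {X : Over (SI k I)} (x y : X ⟶ (hPull k I).obj G) :
    (iPull k I).map (c.value x y) = 1 := by
  rw [C2.value, Functor.map_comp, Functor.map_comp, c.toTangent_mem, MonObj.comp_one,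
    MonObj.comp_one]

/-- The multiplication `(x, y) ↦ (1 + c(x,y)) x y` on `h^* G`. -/
def C2.twistedMul (c : C2 I G) :
    (hPull k I).obj G ⊗ (hPull k I).obj G ⟶ (hPull k I).obj G :=
  c.value (fst _ _) (snd _ _) * (fst _ _ * snd _ _)

lemma C2.lift_twistedMul (c : C2 I G) {X : Over (SI k I)} (x y : X ⟶ (hPull k I).obj G) :
    lift x y ≫ c.twistedMul = c.value x y * (x * y) := by
  simp only [C2.twistedMul, MonObj.comp_mul, C2.comp_value, lift_fst, lift_snd]

lemma C2.iPull_map_value_mul (c : C2 I G) {X : Over (SI k I)}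
    (x y z : X ⟶ (hPull k I).obj G) :
    (iPull k I).map (c.value x y * z) = (iPull k I).map z := by
  rw [Functor.map_mul, c.iPull_map_value, one_mul]

lemma C2.iPull_map_value_inv (c : C2 I G) {X : Over (SI k I)} (x y : X ⟶ (hPull k I).obj G) :
    (iPull k I).map (c.value x y)⁻¹ = (iPull k I).map 1 := by
  have h1 := c.iPull_map_value_mul x y (c.value x y)⁻¹
  rw [mul_inv_cancel] at h1
  exact h1.symm

variable [IsAffine G.left]

lemma C2.toTangent_eval (c : C2 I G) {T : Over (S k)} (u v : T ⟶ G) :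
    (c.eval u v).toTangent = c.value ((hPull k I).map u) ((hPull k I).map v) := by
  rw [C2.value, Functor.Monoidal.lift_μ_assoc]; rfl

instance isAffine_tensor_left : IsAffine (G ⊗ G).left :=
  inferInstanceAs (IsAffine (pullback G.hom G.hom))

/-- The morphism `c` is trivial on the special fibre, so `comp_eq_comp_of_iPull_map_eq_one` applies
to it. This is where `I² = 0` enters the twisted multiplication: infinitesimal corrections to the
arguments of `c` can be discarded. -/
lemma C2.value_congr (c : C2 I G) {X : Over (SI k I)} {x x' y y' : X ⟶ (hPull k I).obj G}
    (hx : (iPull k I).map x = (iPull k I).map x') (hy : (iPull k I).map y = (iPull k I).map y') :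
    c.value x y = c.value x' y' := by
  rw [C2.value, C2.value, ← Category.assoc, ← Category.assoc]
  refine comp_eq_comp_of_iPull_map_eq_one ?_ c.toTangent_mem
  rw [Functor.map_comp, Functor.map_comp, iPull_map_lift_congr hx hy]

/-- The definition of `Z2` only tests points of the form `h^* u`. These suffice because `h^*`
preserves products: any three `X`-points are pulled back from the universal triple on `h^*(G × G ×
G)`. -/
lemma mem_Z2_iff_value (c : C2 I G) : c ∈ Z2 I G ↔
    ∀ (X : Over (SI k I)) (x y z : X ⟶ (hPull k I).obj G),
      c.value x y * c.value (x * y) z = x * c.value y z * x⁻¹ * c.value x (y * z) := by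
  refine ⟨fun hc X x y z ↦ ?_, fun hc T u v w ↦ Lie.ext ?_⟩
  · let p : X ⟶ (hPull k I).obj ((G ⊗ G) ⊗ G) :=
      lift (lift x y ≫ Functor.LaxMonoidal.μ (hPull k I) G G) z ≫
        Functor.LaxMonoidal.μ (hPull k I) (G ⊗ G) G
    let u : (G ⊗ G) ⊗ G ⟶ G := fst _ _ ≫ fst _ _
    let v : (G ⊗ G) ⊗ G ⟶ G := fst _ _ ≫ snd _ _
    let w : (G ⊗ G) ⊗ G ⟶ G := snd _ _
    have hu : p ≫ (hPull k I).map u = x := by simp [p, u]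
    have hv : p ≫ (hPull k I).map v = y := by simp [p, v]
    have hw : p ≫ (hPull k I).map w = z := by simp [p, w]
    have := congr(p ≫ $(congrArg Lie.toTangent (hc _ u v w)))
    simpa only [Lie.toTangent_add, toTangent_Ad, C2.toTangent_eval, Functor.map_mul,
      MonObj.comp_mul, GrpObj.comp_inv, C2.comp_value, hu, hv, hw] using this
  · simp only [Lie.toTangent_add, toTangent_Ad, C2.toTangent_eval, Functor.map_mul, hc]

variable {c : C2 I G} (hc : c ∈ Z2 I G)
include hc

/-- The cocycle identity at `(1, 1, x)`. Cocycles are not assumed normalized, so `c(1,1)` may be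
nonzero; this lemma and the next are what make its inverse a two-sided unit. -/
lemma value_one_left {X : Over (SI k I)} (x : X ⟶ (hPull k I).obj G) :
    c.value 1 x = c.value 1 1 := by
  have := (mem_Z2_iff_value c).1 hc X 1 1 x
  simpa using this.symm

lemma value_one_right {X : Over (SI k I)} (x : X ⟶ (hPull k I).obj G) :
    c.value x 1 = x * c.value 1 1 * x⁻¹ := by
  have := (mem_Z2_iff_value c).1 hc X x 1 1
  simpa using this

omit hc in
lemma mem_Z2_iff_twistedMul_assoc : c ∈ Z2 I G ↔
    ∀ (X : Over (SI k I)) (x y z : X ⟶ (hPull k I).obj G),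
      lift (lift x y ≫ c.twistedMul) z ≫ c.twistedMul =
        lift x (lift y z ≫ c.twistedMul) ≫ c.twistedMul := by
  rw [mem_Z2_iff_value]
  refine forall₄_congr fun X x y z ↦ ?_
  simp only [C2.lift_twistedMul]
  -- Inside `c`, the twisted products of `x, y` and of `y, z` may be replaced by the ordinary ones.
  rw [c.value_congr (c.iPull_map_value_mul x y (x * y)) (rfl : (iPull k I).map z = _),
    c.value_congr (rfl : (iPull k I).map x = _) (c.iPull_map_value_mul y z (y * z))]
  have h1 := mul_comm_of_restriction_eq_one _ _ _ (c.iPull_map_value x y)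
    (c.iPull_map_value (x * y) z)
  have h2 : c.value x (y * z) * (x * c.value y z * x⁻¹) =
      x * c.value y z * x⁻¹ * c.value x (y * z) :=
    mul_comm_of_restriction_eq_one _ _ _ (c.iPull_map_value x (y * z)) (by
      rw [Functor.map_mul, Functor.map_mul, c.iPull_map_value, mul_one, ← Functor.map_mul,
        mul_inv_cancel, Functor.map_one])
  -- The two sides of associativity are those of the cocycle identity times `xyz`, up to the order
  -- of the infinitesimal factors, which commute by `h1` and `h2`.
  rw [h1, ← h2, ← mul_left_inj (x * y * z)]
  simp [mul_assoc]

end Cocycle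

/-! ### Cocycles and lifted group structures -/

section Lifts

variable {k I : Type u} [CommRing k] [AddCommGroup I] [Module k I] [Module kᵐᵒᵖ I]
  [IsCentralScalar k I] {G : Over (S k)} [GrpObj G]

lemma isSpecialFibreHom_iff_lift {X : Over (SI k I)} (grp : GrpObj X)
    (e : (iPull k I).obj X ⟶ G) : IsSpecialFibreHom grp e ↔
      ∀ (T : Over (SI k I)) (x y : T ⟶ X),
        (iPull k I).map (lift x y ≫ grp.mul) ≫ e =
          ((iPull k I).map x ≫ e) * ((iPull k I).map y ≫ e) := by
  refine ⟨fun he T x y ↦ ?_, fun he ↦ isMonHom_of_mul e ?_⟩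
  · have : IsMonHom e := he
    rw [← MonObj.mul_comp, ← Functor.map_mul, Hom.mul_def]
  · have h1 := congr(Functor.LaxMonoidal.μ (iPull k I) X X ≫ $(he _ (fst X X) (snd X X)))
    rw [lift_fst_snd, Category.id_comp, MonObj.comp_mul] at h1
    rw [Functor.obj.μ_def, Category.assoc, h1, Hom.mul_def]
    congr 1
    ext <;> simp

variable (k I) in
-- Two points of `h^* G` are pulled back from the universal pair on `h^*(G × G)`, where their
-- product is `h^*` of the product in `G` and naturality of `i^* h^* ≅ id` applies.
lemma isSpecialFibreHom_specialFibre :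
    IsSpecialFibreHom (inferInstance : GrpObj ((hPull k I).obj G)) (specialFibre k I G).hom := by
  rw [isSpecialFibreHom_iff_lift]
  intro T x y
  let p : T ⟶ (hPull k I).obj (G ⊗ G) := lift x y ≫ Functor.LaxMonoidal.μ (hPull k I) G G
  have hx : x = p ≫ (hPull k I).map (fst G G) := by simp [p]
  have hy : y = p ≫ (hPull k I).map (snd G G) := by simp [p]
  have hxy : lift x y ≫ μ[(hPull k I).obj G] = p ≫ (hPull k I).map (fst G G * snd G G) := by
    rw [← Hom.mul_def, Functor.map_mul, MonObj.comp_mul, ← hx, ← hy]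
  change (iPull k I).map (lift x y ≫ μ[(hPull k I).obj G]) ≫ _ = _
  rw [hxy, hx, hy]
  simp only [Functor.map_comp, Category.assoc, specialFibre_natural, MonObj.comp_mul]

/-- Both multiplications induce that of `G` on the special fibre. Their quotient is thus
infinitesimal, which is how a cochain is extracted from a lift. -/
lemma LiftedGroupStructure.iPull_map_lift_mul (s : LiftedGroupStructure I G) {X : Over (SI k I)}
    (x y : X ⟶ (hPull k I).obj G) :
    (iPull k I).map (lift x y ≫ s.grp.mul) = (iPull k I).map (x * y) := by
  rw [← cancel_mono (specialFibre k I G).hom, (isSpecialFibreHom_iff_lift _ _).1 s.lifts,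
    Hom.mul_def]
  exact ((isSpecialFibreHom_iff_lift _ _).1 (isSpecialFibreHom_specialFibre k I) X x y).symm

lemma LiftedGroupStructure.ext_mul {s s' : LiftedGroupStructure I G}
    (hs : s.grp.mul = s'.grp.mul) : s = s' := by
  obtain ⟨g, hg⟩ := s
  obtain ⟨g', hg'⟩ := s'
  obtain rfl : g = g' := GrpObj.ext _ _ (MonObj.ext _ _ hs)
  rfl

lemma C2.value_fst_snd (c : C2 I G) :
    c.value ((hPull k I).map (fst G G)) ((hPull k I).map (snd G G)) = c.toTangent := by
  rw [C2.value, Functor.Monoidal.lift_μ_assoc, lift_fst_snd, CategoryTheory.Functor.map_id,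
    Category.id_comp]

variable [IsAffine G.left]

/-- The group structure on `h^* G` with multiplication `(x, y) ↦ (1 + c(x,y)) x y`. -/
abbrev twistedGrp (c : Z2 I G) : GrpObj ((hPull k I).obj G) :=
  -- The unit is `c(1,1)⁻¹` in multiplicative notation. The inverse `x⁻¹ c(x,x⁻¹)⁻¹ c(1,1)⁻¹` is
  -- found by solving `x ⊙ n = c(1,1)⁻¹`, using that `c(x,n) = c(x,x⁻¹)` because `n` and `x⁻¹` have
  -- the same special fibre.
  grpObjOfPointwise c.1.twistedMul (c.1.value 1 1)⁻¹
    ((𝟙 _)⁻¹ * (c.1.value (𝟙 _) (𝟙 _)⁻¹)⁻¹ * (c.1.value 1 1)⁻¹)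
    (mem_Z2_iff_twistedMul_assoc.1 c.2 _)
    (by
      intro T x
      rw [C2.lift_twistedMul, GrpObj.comp_inv, C2.comp_value, MonObj.comp_one,
        c.1.value_congr (c.1.iPull_map_value_inv 1 1) (rfl : (iPull k I).map x = _),
        value_one_left c.2, mul_inv_cancel_left])
    (by
      intro T x
      rw [C2.lift_twistedMul, GrpObj.comp_inv, C2.comp_value, MonObj.comp_one,
        c.1.value_congr (rfl : (iPull k I).map x = _) (c.1.iPull_map_value_inv 1 1),
        value_one_right c.2]
      group)
    (by
      rw [C2.lift_twistedMul, c.1.value_congr (rfl : (iPull k I).map (𝟙 _) = _)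
        (y' := (𝟙 ((hPull k I).obj G))⁻¹), GrpObj.comp_inv, C2.comp_value, MonObj.comp_one]
      · group
      · rw [Functor.map_mul, Functor.map_mul, C2.iPull_map_value_inv, C2.iPull_map_value_inv,
          Functor.map_one, mul_one, mul_one])

/-- The group structure `𝒢_c` on `h^* G` attached to a `2`-cocycle `c`. -/
def twistedStructure (c : Z2 I G) : LiftedGroupStructure I G where
  grp := twistedGrp c
  lifts := by
    rw [isSpecialFibreHom_iff_lift]
    intro T x y
    change (iPull k I).map (lift x y ≫ c.1.twistedMul) ≫ _ = _
    rw [C2.lift_twistedMul, C2.iPull_map_value_mul]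
    exact (isSpecialFibreHom_iff_lift _ _).1 (isSpecialFibreHom_specialFibre k I) T x y

lemma twistedStructure_injective :
    Function.Injective (twistedStructure : Z2 I G → LiftedGroupStructure I G) := by
  intro c c' hcc
  have h1 : c.1.twistedMul = c'.1.twistedMul := congr(($hcc).grp.mul)
  apply Subtype.ext
  apply Lie.ext
  have h2 := congr(lift ((hPull k I).map (fst G G)) ((hPull k I).map (snd G G)) ≫ $h1)
  rw [C2.lift_twistedMul, C2.lift_twistedMul, C2.value_fst_snd, C2.value_fst_snd] at h2
  exact mul_right_cancel h2

lemma twistedStructure_surjective :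
    Function.Surjective (twistedStructure : Z2 I G → LiftedGroupStructure I G) := by
  intro s
  let a : (hPull k I).obj (G ⊗ G) ⟶ (hPull k I).obj G := (hPull k I).map (fst G G)
  let b : (hPull k I).obj (G ⊗ G) ⟶ (hPull k I).obj G := (hPull k I).map (snd G G)
  -- The cochain is `(a ⊙ b)(ab)⁻¹` at the universal pair; associativity of `⊙` will make it a
  -- cocycle.
  let c : C2 I G := Lie.mk ((lift a b ≫ s.grp.mul) * (a * b)⁻¹) (by
    rw [Functor.map_mul, s.iPull_map_lift_mul, ← Functor.map_mul, mul_inv_cancel,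
      Functor.map_one])
  have hs : s.grp.mul = c.twistedMul := by
    have h1 : c.value (fst _ _) (snd _ _) = s.grp.mul * (fst _ _ * snd _ _)⁻¹ := by
      simp [C2.value, c, a, b, MonObj.comp_mul, GrpObj.comp_inv, comp_lift_assoc,
        -mul_inv_rev]
    rw [C2.twistedMul, h1, inv_mul_cancel_right]
  have hc : c ∈ Z2 I G := by
    rw [mem_Z2_iff_twistedMul_assoc, ← hs]
    intro X x y z
    exact (@Hom.monoid _ _ _ _ X s.grp.toMonObj).mul_assoc x y z
  exact ⟨⟨c, hc⟩, LiftedGroupStructure.ext_mul hs.symm⟩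

/-- The bijection between `2`-cocycles and the group structures on `h^* G` lifting that of `G`. -/
def twistedStructureEquiv : Z2 I G ≃ LiftedGroupStructure I G :=
  Equiv.ofBijective twistedStructure ⟨twistedStructure_injective, twistedStructure_surjective⟩

end Lifts

/-! ### Coboundaries and isomorphism classes of rigid deformations -/

section Classes

variable {k I : Type u} [CommRing k] [AddCommGroup I] [Module k I] [Module kᵐᵒᵖ I]
  [IsCentralScalar k I] {G : Over (S k)} [GrpObj G] [IsAffine G.left]

/-- The relation is rearranged as `ψ(uv) + c(u,v) = c'(u,v) + ψ(u) + Ad(u) ψ(v)`, which is free of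
subtraction, and checked on the universal pair. In this form it matches the homomorphism condition.
-/
lemma sub_eq_coboundary_iff_value (c c' : C2 I G) (ψ : C1 I G) : c - c' = coboundary I G ψ ↔
    ∀ (X : Over (SI k I)) (x y : X ⟶ (hPull k I).obj G),
      (x * y) ≫ ψ.toTangent * c.value x y =
        c'.value x y * (x ≫ ψ.toTangent * (x * y ≫ ψ.toTangent * x⁻¹)) := by
  have h1 : c - c' = coboundary I G ψ ↔ C1.eval ψ (fst G G * snd G G) + c =
      c' + (C1.eval ψ (fst G G) + Ad (fst G G) (C1.eval ψ (snd G G))) := by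
    change _ = Ad (fst G G) (C1.eval ψ (snd G G)) - C1.eval ψ (fst G G * snd G G) +
      C1.eval ψ (fst G G) ↔ _
    rw [sub_eq_iff_eq_add, ← sub_eq_zero, ← sub_eq_zero (a := C1.eval _ _ + c)]
    refine Eq.congr ?_ rfl
    abel
  have h2 : C1.eval ψ (fst G G * snd G G) + c =
      c' + (C1.eval ψ (fst G G) + Ad (fst G G) (C1.eval ψ (snd G G))) ↔
      ((hPull k I).map (fst G G) * (hPull k I).map (snd G G)) ≫ ψ.toTangent * c.toTangent =
      c'.toTangent * ((hPull k I).map (fst G G) ≫ ψ.toTangent * ((hPull k I).map (fst G G) *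
        (hPull k I).map (snd G G) ≫ ψ.toTangent * ((hPull k I).map (fst G G))⁻¹)) := by
    rw [Lie.ext_iff, ← Functor.map_mul]
    rfl
  rw [h1, h2]
  refine ⟨fun h X x y ↦ ?_, fun h ↦ ?_⟩
  · have hx : (lift x y ≫ Functor.LaxMonoidal.μ (hPull k I) G G) ≫ (hPull k I).map (fst G G) =
        x := by
      simp
    have hy : (lift x y ≫ Functor.LaxMonoidal.μ (hPull k I) G G) ≫ (hPull k I).map (snd G G) =
        y := by
      simp
    have h3 := congr((lift x y ≫ Functor.LaxMonoidal.μ (hPull k I) G G) ≫ $h)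
    simp only [← C2.value_fst_snd, MonObj.comp_mul, GrpObj.comp_inv, C2.comp_value, hx, hy,
      ← Category.assoc _ _ ψ.toTangent] at h3
    exact h3
  · have h3 := h _ ((hPull k I).map (fst G G)) ((hPull k I).map (snd G G))
    rwa [C2.value_fst_snd, C2.value_fst_snd] at h3

/-- For `x ↦ (1 + ψ(x)) x`, the homomorphism condition simplifies because `ψ` and `c'` ignore the
infinitesimal factors in their arguments. Cancelling `xy` on the right leaves the relation of
`sub_eq_coboundary_iff_value`. -/
lemma isMonHom_iff_sub_eq_coboundary (c c' : Z2 I G) (ψ : C1 I G) :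
    @IsMonHom _ _ _ _ _ (twistedGrp c).toMonObj (twistedGrp c').toMonObj
        (ψ.toTangent * 𝟙 ((hPull k I).obj G)) ↔
      c.1 - c'.1 = coboundary I G ψ := by
  rw [sub_eq_coboundary_iff_value, @isMonHom_iff_lift _ _ _ _ _ (twistedGrp c) (twistedGrp c')]
  refine forall₃_congr fun X x y ↦ ?_
  change lift x y ≫ c.1.twistedMul ≫ _ = lift _ _ ≫ c'.1.twistedMul ↔ _
  have hψ : ∀ z : X ⟶ (hPull k I).obj G,
      (iPull k I).map (z ≫ ψ.toTangent * z) = (iPull k I).map z := fun z ↦ by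
    rw [Functor.map_mul, Functor.map_comp, ψ.toTangent_mem, MonObj.comp_one, one_mul]
  rw [← Category.assoc, C2.lift_twistedMul, C2.lift_twistedMul]
  simp only [MonObj.comp_mul _ ψ.toTangent, Category.comp_id]
  rw [c'.1.value_congr (hψ x) (hψ y),
    comp_eq_comp_of_iPull_map_eq_one (c.1.iPull_map_value_mul x y (x * y)) ψ.toTangent_mem]
  conv_rhs => rw [← mul_left_inj (x * y)]
  simp [mul_assoc]

/-- The automorphism `x ↦ (1 + ψ(x)) x` of the `k[I]`-scheme `h^* G`. -/
def twistIso (ψ : C1 I G) : (hPull k I).obj G ≅ (hPull k I).obj G where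
  hom := ψ.toTangent * 𝟙 _
  inv := ψ.toTangent⁻¹ * 𝟙 _
  hom_inv_id := by
    have h1 : (ψ.toTangent * 𝟙 _) ≫ ψ.toTangent = 𝟙 _ ≫ ψ.toTangent :=
      comp_eq_comp_of_iPull_map_eq_one (by rw [Functor.map_mul, ψ.toTangent_mem, one_mul])
        ψ.toTangent_mem
    rw [MonObj.comp_mul, GrpObj.comp_inv, h1, Category.comp_id, Category.id_comp,
      inv_mul_cancel_left]
  inv_hom_id := by
    have h1 : (ψ.toTangent⁻¹ * 𝟙 _) ≫ ψ.toTangent = 𝟙 _ ≫ ψ.toTangent :=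
      comp_eq_comp_of_iPull_map_eq_one
        (by rw [Functor.map_mul, ← Lie.toTangent_neg, Lie.toTangent_mem, one_mul])
        ψ.toTangent_mem
    rw [MonObj.comp_mul, h1, Category.comp_id, Category.id_comp, mul_inv_cancel_left]

/-- The deformations `𝒢_c` and `𝒢_c'` are isomorphic if and only if `c` and `c'` are
cohomologous. -/
lemma toRigidDeformation_equiv_iff (c c' : Z2 I G) :
    (twistedStructure c).toRigidDeformation ≈ (twistedStructure c').toRigidDeformation ↔
      c.1 - c'.1 ∈ B2 I G := by
  constructor
  · rintro ⟨f, hf, hf'⟩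
    let f₀ : (hPull k I).obj G ⟶ (hPull k I).obj G := f.hom
    have h1 : (iPull k I).map f₀ = 𝟙 _ := by
      rw [← cancel_mono (specialFibre k I G).hom, Category.id_comp]
      exact hf'
    -- Here `(𝟙 _)⁻¹` is the group inverse of the identity point of `h^* G`. The quotient `f₀ · (𝟙
    -- _)⁻¹` is the `1 + ψ` for which `f₀` is `x ↦ (1 + ψ(x)) x`.
    have h2 : (iPull k I).map (f₀ * (𝟙 _)⁻¹) = 1 := by
      have h3 : (iPull k I).map f₀ = (iPull k I).map (𝟙 _) := by
        rw [h1, CategoryTheory.Functor.map_id]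
      rw [Functor.map_mul, h3, ← Functor.map_mul, mul_inv_cancel, Functor.map_one]
    refine ⟨Lie.mk _ h2, ((isMonHom_iff_sub_eq_coboundary c c' _).1 ?_).symm⟩
    rw [Lie.toTangent_mk, inv_mul_cancel_right]
    exact hf
  · rintro ⟨ψ, hψ⟩
    refine ⟨twistIso ψ, (isMonHom_iff_sub_eq_coboundary c c' ψ).2 hψ.symm, ?_⟩
    change (iPull k I).map (ψ.toTangent * 𝟙 _) ≫ (specialFibre k I G).hom =
      (specialFibre k I G).hom
    rw [Functor.map_mul, ψ.toTangent_mem, one_mul, CategoryTheory.Functor.map_id,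
      Category.id_comp]

omit [IsAffine G.left] in
/-- A rigid deformation is isomorphic to `h^* G` with a lifted group structure. -/
lemma exists_toRigidDeformation_equiv (D : RigidDeformation I G) :
    ∃ s : LiftedGroupStructure I G, s.toRigidDeformation ≈ D := by
  obtain ⟨D, σ, hσ⟩ := D
  -- Because `σ` lifts the identity of the special fibre, `t` identifies `specialFibre` with `D.e`.
  -- The group structure of `D` transported along `t` is therefore a lift of that of `G`.
  let t : (hPull k I).obj G ≅ D.X := (hPull k I).mapIso D.e.symm ≪≫ σ
  have ht : (iPull k I).map t.hom ≫ D.e.hom = (specialFibre k I G).hom := by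
    simp [t, hσ, reassoc_of% specialFibre_natural k I D.e.inv]
  have hmul : ∀ (T : Over (SI k I)) (x y : T ⟶ (hPull k I).obj G),
      lift x y ≫ (GrpObj.ofIso t.symm).mul ≫ t.hom = lift (x ≫ t.hom) (y ≫ t.hom) ≫ μ[D.X] := by
    intro T x y
    change lift x y ≫ ((t.hom ⊗ₘ t.hom) ≫ μ[D.X] ≫ t.inv) ≫ t.hom = _
    simp
  let s : LiftedGroupStructure I G :=
    { grp := GrpObj.ofIso t.symm
      lifts := by
        rw [isSpecialFibreHom_iff_lift]
        intro T x y
        have h1 := (isSpecialFibreHom_iff_lift D.grp D.e.hom).1 D.isMonHom_e T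
          (x ≫ t.hom) (y ≫ t.hom)
        rw [← hmul] at h1
        simpa only [Functor.map_comp, Category.assoc, ht] using h1 }
  exact ⟨s, t, (@isMonHom_iff_lift _ _ _ _ _ s.grp D.grp t.hom).2 hmul, ht⟩

/-- The map from `H²(G, Lie(G,I))` to isomorphism classes of rigid deformations, induced by
`c ↦ 𝒢_c`. -/
def deformationClass : H2 I G → RigidDeformationClass I G :=
  Quotient.lift (fun c ↦ Quotient.mk _ (twistedStructure c).toRigidDeformation) fun c c' h ↦ by
    apply Quotient.sound
    rw [toRigidDeformation_equiv_iff]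
    have h1 := QuotientAddGroup.leftRel_apply.1 h
    rw [AddSubgroup.mem_addSubgroupOf] at h1
    simpa [sub_eq_add_neg, add_comm] using neg_mem h1

lemma deformationClass_bijective :
    Function.Bijective (deformationClass : H2 I G → RigidDeformationClass I G) := by
  constructor
  · rintro ⟨c⟩ ⟨c'⟩ h
    have h1 := (toRigidDeformation_equiv_iff c c').1 (Quotient.exact h)
    refine QuotientAddGroup.eq.2 ?_
    rw [AddSubgroup.mem_addSubgroupOf]
    simpa [sub_eq_add_neg, add_comm] using neg_mem h1
  · rintro ⟨D⟩
    obtain ⟨s, hs⟩ := exists_toRigidDeformation_equiv D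
    obtain ⟨c, rfl⟩ := twistedStructure_surjective s
    exact ⟨QuotientAddGroup.mk c, Quotient.sound hs⟩

end Classes

end GroupDeformation

end

theorem mainTheorem3 {k I : Type u} [CommRing k] [AddCommGroup I] [Module k I] [Module kᵐᵒᵖ I]
    [IsCentralScalar k I] [Module.Free k I] [Module.Finite k I]
    (G : Over (Spec (.of k))) [GrpObj G] [IsAffine G.left] :
    ∃ (Φ : GroupDeformation.Z2 I G ≃ GroupDeformation.LiftedGroupStructure I G)
      (Ψ : GroupDeformation.H2 I G ≃ GroupDeformation.RigidDeformationClass I G),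
      (∀ (c : GroupDeformation.Z2 I G) (T : Over (Spec (.of k))) (u v : T ⟶ G),
        lift ((GroupDeformation.hPull k I).map u) ((GroupDeformation.hPull k I).map v) ≫
            (Φ c).grp.mul =
          (c.1.eval u v).toTangent * (GroupDeformation.hPull k I).map (u * v)) ∧
      (∀ c : GroupDeformation.Z2 I G,
        Ψ (QuotientAddGroup.mk c) = Quotient.mk _ (Φ c).toRigidDeformation) := by
  refine ⟨GroupDeformation.twistedStructureEquiv,
    Equiv.ofBijective _ GroupDeformation.deformationClass_bijective, fun c T u v ↦ ?_,
    fun c ↦ rfl⟩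
  rw [GroupDeformation.C2.toTangent_eval, Functor.map_mul]
  exact c.1.lift_twistedMul _ _
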